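/- Let $(\mathcal C,d)$ be a finite nonempty metric space with $n=|\mathcal C|$ points (distinct points may be at distance $0$), and let $k\ge 1$ and $1\le\ell\le n$ be integers. For nonempty $S\subseteq\mathcal C$ put $d(j,S)=\min_{a\in S}d(j,a)$, and let $\mathrm{Top}_\ell(d(\mathcal C,S))$ be the sum of the $\ell$ largest entries of the vector $(d(j,S))_{j\in\mathcal C}$. Let $\mathrm{OPT}$ be the minimum of $\mathrm{Top}_\ell(d(\mathcal C,S))$ over nonempty $S\subseteq\mathcal C$ with $|S|\le k$, let $S^*$ be any set attaining this minimum, and let $t^*_\ell$ be the $\ell$-th largest entry of $(d(j,S^*))_{j\in\mathcal C}$. For $t_\ell\ge 0$, adaptive sampling with parameter $t_\ell$ starts with $S_0=\varnothing$ and, for $i=1,\dots,N$ with $N=\lceil 28(k+\sqrt k)\rceil$, samples a point $s_i\in\mathcal C$ and sets $S_i=S_{i-1}\cup\{s_i\}$; it returns $S_N$. The point $s_1$ is uniform on $\mathcal C$ (all points are at distance $d(j,\varnothing)=\infty$); for $i\ge 2$, $s_i$ is chosen, given $S_{i-1}$, with probability proportional to $(d(s_i,S_{i-1})-2t_\ell)^+$,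 where $x^+=\max\{x,0\}$. If all these weights are $0$, then $s_i$ is chosen by an arbitrary (possibly randomized) rule depending on $S_{i-1}$. There is an absolute constant $c>0$ such that the following holds for all $(\mathcal C,d)$, $k$, $\ell$, $S^*$ as above, every such rule, every $\varepsilon>0$, and every $t_\ell$ with $$t^*_\ell\le t_\ell\le\max\Bigl\{(1+\varepsilon)\,t^*_\ell,\ \frac{\varepsilon\cdot\mathrm{OPT}}{\ell}\Bigr\}.$$ The set $S_N$ returned by adaptive sampling with parameter $t_\ell$ is nonempty and always has at most $56k$ elements, and with probability at least $c$ $$\mathrm{Top}_\ell(d(\mathcal C,S_N))\le 35(1+\varepsilon)\cdot\mathrm{OPT}.$$ -/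

import Mathlib

namespace LCentrum

/-- The entries of the vector `v`, sorted in non-increasing order. -/
noncomputable def sortedDesc {C : Type*} [Fintype C] (v : C → ℝ) : List ℝ :=
  ((Finset.univ : Finset C).val.map v).sort (fun a b => b ≤ a)

/-- `Top_ℓ(v)`: the sum of the `ℓ` largest entries of `v`. -/
noncomputable def topSum {C : Type*} [Fintype C] (l : ℕ) (v : C → ℝ) : ℝ :=
  ((sortedDesc v).take l).sum

/-- The `ℓ`-th largest entry of `v`, for `1 ≤ ℓ ≤ n` (entries are counted with multiplicity). -/
noncomputable def nthLargest {C : Type*} [Fintype C] (l : ℕ) (v : C → ℝ) : ℝ :=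
  (sortedDesc v).getD (l - 1) 0

/-- The cost vector `d(C, S)`, whose `j`-th entry is `d(j, S) = min_{a ∈ S} d(j, a)`
(used for nonempty `S` only). -/
noncomputable def costVec {C : Type*} [PseudoMetricSpace C] (S : Finset C) (j : C) : ℝ :=
  Metric.infDist j (S : Set C)

/-- The `Top_ℓ`-cost of the center-set `S`. -/
noncomputable def cost {C : Type*} [Fintype C] [PseudoMetricSpace C] (l : ℕ) (S : Finset C) : ℝ :=
  topSum l (costVec S)

/-- Feasible solutions: nonempty sets of at most `k` centers. -/
def IsSolution {C : Type*} (k : ℕ) (S : Finset C) : Prop :=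
  S.Nonempty ∧ S.card ≤ k

/-- The optimal `ℓ`-centrum cost with at most `k` centers. -/
noncomputable def opt (C : Type*) [Fintype C] [PseudoMetricSpace C] (k l : ℕ) : ℝ :=
  sInf {x : ℝ | ∃ S : Finset C, IsSolution k S ∧ x = cost l S}

/-- `S` is an optimal solution. -/
def IsOptimal {C : Type*} [Fintype C] [PseudoMetricSpace C] (k l : ℕ) (S : Finset C) : Prop :=
  IsSolution k S ∧ cost l S = opt C k l

/-- The sampling weight `(d(j, S) - 2t)⁺`. -/
noncomputable def weight {C : Type*} [PseudoMetricSpace C] (t : ℝ) (S : Finset C) (j : C) :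
    ENNReal :=
  ENNReal.ofReal (max (costVec S j - 2 * t) 0)

theorem tsum_weight_ne_top {C : Type*} [Fintype C] [PseudoMetricSpace C] (t : ℝ) (S : Finset C) :
    ∑' j, weight t S j ≠ ⊤ := by
  rw [tsum_fintype]
  exact ENNReal.sum_ne_top.2 fun j _ => ENNReal.ofReal_ne_top

open Classical in
/-- The law of the next center, given the current center-set `S`. If `S` is empty, then
`d(j, S) = ∞` for every `j`, so all points have equal weight and the choice is uniform. If `S` is
nonempty, `j` is drawn with probability proportional to `(d(j, S) - 2t)⁺`. When all these weights
vanish, no law is prescribed, and an arbitrary rule `fallback` is used (a rule supported on `S`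
amounts to stopping). -/
noncomputable def nextCenter {C : Type*} [Fintype C] [Nonempty C] [PseudoMetricSpace C] (t : ℝ)
    (fallback : Finset C → PMF C) (S : Finset C) : PMF C :=
  if S = ∅ then PMF.uniformOfFintype C
  else if h : ∑' j, weight t S j = 0 then fallback S
  else PMF.normalize (weight t S) h (tsum_weight_ne_top t S)

open Classical in
/-- The law of the center-set `S_i` after `i` rounds of adaptive sampling with parameter `t`. -/
noncomputable def adSample {C : Type*} [Fintype C] [Nonempty C] [PseudoMetricSpace C] (t : ℝ)
    (fallback : Finset C → PMF C) : ℕ → PMF (Finset C)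
  | 0 => PMF.pure ∅
  | i + 1 => (adSample t fallback i).bind fun S =>
      (nextCenter t fallback S).map fun s => insert s S

/-- The number of rounds, `⌈28 (k + √k)⌉`. -/
noncomputable def rounds (k : ℕ) : ℕ := ⌈28 * ((k : ℝ) + Real.sqrt k)⌉₊

end LCentrum

/-!
For a threshold `s ≥ 0`, the `l` largest entries of a vector `v` sum to at most
`l * s + ∑ j, (v j - s)⁺`, with equality when `s` is the `l`-th largest entry. So a solution `S` is
cheap as soon as `potential t S = ∑ j, (d(j, S) - 2t)⁺` is small, and this is the quantity whose
terms are the sampling weights.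

Split the points into clusters by their nearest center in the optimal solution. The padded cost of
a point is its excess `(d(j, S*) - t)⁺` plus `2t` if that excess is positive. Since at most `l`
points have positive excess, the padding is at most `2 * t * l`, and the total padded cost is at
most `2 * (1 + ε) * OPT` (`threshold_and_paddedCost_le`). Call a cluster bad for `S` if its part of
the potential exceeds `7` times its padded cost. When the next center falls into a bad cluster, the
cluster becomes good with conditional probability at least `2 / 3`
(`two_thirds_weight_repairs`): a point that fails to repair the cluster has a large positive
excess, so such points are few by Markov's inequality, and the triangle inequality bounds the weight
of each of them by the average weight in the cluster plus its own padded cost. The padding is what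
absorbs the loss of `2t` in this triangle inequality.

While the potential exceeds `33 * (1 + ε) * OPT`, the good clusters hold at most `14 / 33` of the
weight, so a round repairs a bad cluster with probability at least `1 / 3`
(`third_weight_repairs`). Neither the potential nor the number of bad clusters ever increases.
Hence, if `π` is the probability that the potential is still large after `m + 1` rounds, each of
the last `m` rounds lowers the expected number of bad clusters by at least `π / 3`; this number is
at most `k` at the start, so `π ≤ 3k / m` (`mul_expect_potential_large_le`). With more than `28k`
rounds this is at most `3 / 28`, and a potential of at most `33 * (1 + ε) * OPT` gives cost at most
`2 * l * t + 33 * (1 + ε) * OPT ≤ 35 * (1 + ε) * OPT`.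
-/

namespace LCentrum

/-! ### Sums of the largest entries -/

section TopSum

variable {C : Type*} [Fintype C]

theorem sortedDesc_coe (v : C → ℝ) :
    (sortedDesc v : Multiset ℝ) = (Finset.univ : Finset C).val.map v :=
  Multiset.sort_eq _ _

theorem length_sortedDesc (v : C → ℝ) : (sortedDesc v).length = Fintype.card C := by
  rw [sortedDesc, Multiset.length_sort, Multiset.card_map]; rfl

theorem sum_map_sortedDesc (v : C → ℝ) (g : ℝ → ℝ) :
    ((sortedDesc v).map g).sum = ∑ j, g (v j) := by
  rw [← Multiset.sum_coe, ← Multiset.map_coe, sortedDesc_coe, Multiset.map_map]; rfl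

theorem pairwise_sortedDesc (v : C → ℝ) : (sortedDesc v).Pairwise (fun a b => b ≤ a) :=
  Multiset.pairwise_sort _ _

theorem nthLargest_eq_getElem {l : ℕ} (h1 : 1 ≤ l) (hl : l ≤ Fintype.card C) (v : C → ℝ) :
    nthLargest l v = (sortedDesc v)[l - 1]'(by rw [length_sortedDesc]; omega) := by
  rw [nthLargest, List.getD_eq_getElem]

theorem nthLargest_le_of_mem_take {l : ℕ} (h1 : 1 ≤ l) (hl : l ≤ Fintype.card C) (v : C → ℝ)
    {y : ℝ} (hy : y ∈ (sortedDesc v).take l) : nthLargest l v ≤ y := by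
  rw [nthLargest_eq_getElem h1 hl]
  obtain ⟨i, hi, rfl⟩ := List.mem_iff_getElem.1 hy
  rw [List.length_take] at hi
  rw [List.getElem_take]
  rcases eq_or_lt_of_le (show i ≤ l - 1 by omega) with h | h
  · subst h; exact le_rfl
  · exact List.pairwise_iff_getElem.1 (pairwise_sortedDesc v) _ _ _ _ h

theorem le_nthLargest_of_mem_drop {l : ℕ} (h1 : 1 ≤ l) (hl : l ≤ Fintype.card C) (v : C → ℝ)
    {y : ℝ} (hy : y ∈ (sortedDesc v).drop l) : y ≤ nthLargest l v := by
  rw [nthLargest_eq_getElem h1 hl]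
  obtain ⟨i, hi, rfl⟩ := List.mem_iff_getElem.1 hy
  rw [List.getElem_drop]
  exact List.pairwise_iff_getElem.1 (pairwise_sortedDesc v) _ _ _ _ (by omega)

theorem nthLargest_nonneg (l : ℕ) {v : C → ℝ} (hv : ∀ j, 0 ≤ v j) : 0 ≤ nthLargest l v := by
  rw [nthLargest, List.getD_eq_getElem?_getD]
  rcases h : (sortedDesc v)[l - 1]? with _ | y
  · simp
  · have hy : y ∈ (sortedDesc v : Multiset ℝ) := List.mem_of_getElem? h
    rw [sortedDesc_coe, Multiset.mem_map] at hy
    obtain ⟨j, -, rfl⟩ := hy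
    exact hv j

theorem topSum_le_add_sum_posPart (l : ℕ) (v : C → ℝ) {s : ℝ} (hs : 0 ≤ s) :
    topSum l v ≤ l * s + ∑ j, max (v j - s) 0 := by
  have aux : ∀ L : List ℝ, L.sum ≤ L.length * s + (L.map fun y => max (y - s) 0).sum := by
    intro L
    induction L with
    | nil => simp
    | cons a L ih =>
      simp only [List.sum_cons, List.length_cons, List.map_cons, Nat.cast_add, Nat.cast_one]
      linarith [le_max_left (a - s) 0]
  have hdrop : 0 ≤ (((sortedDesc v).drop l).map fun y => max (y - s) 0).sum := by
    refine List.sum_nonneg fun y hy => ?_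
    obtain ⟨z, -, rfl⟩ := List.mem_map.1 hy
    exact le_max_right _ _
  have hlen : (((sortedDesc v).take l).length : ℝ) * s ≤ l * s := by
    refine mul_le_mul_of_nonneg_right ?_ hs
    exact_mod_cast List.length_take_le l _
  rw [← sum_map_sortedDesc v fun y => max (y - s) 0]
  have hsplit : ((sortedDesc v).map fun y => max (y - s) 0).sum =
      (((sortedDesc v).take l).map fun y => max (y - s) 0).sum +
      (((sortedDesc v).drop l).map fun y => max (y - s) 0).sum := by
    rw [← List.sum_append, ← List.map_append, List.take_append_drop]
  have := aux ((sortedDesc v).take l)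
  rw [topSum]
  linarith

/-- The bound `topSum_le_add_sum_posPart` is attained at the threshold `nthLargest l v`; only this
direction is needed. -/
theorem add_sum_posPart_le_topSum {l : ℕ} (h1 : 1 ≤ l) (hl : l ≤ Fintype.card C) (v : C → ℝ) :
    l * nthLargest l v + ∑ j, max (v j - nthLargest l v) 0 ≤ topSum l v := by
  set s := nthLargest l v with hs
  have aux : ∀ L : List ℝ, (∀ y ∈ L, s ≤ y) →
      L.length * s + (L.map fun y => max (y - s) 0).sum = L.sum := by
    intro L
    induction L with
    | nil => simp
    | cons a L ih =>
      intro h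
      have ha : max (a - s) 0 = a - s := max_eq_left (sub_nonneg.2 (h a (by simp)))
      have := ih fun y hy => h y (by simp [hy])
      simp only [List.sum_cons, List.length_cons, List.map_cons, Nat.cast_add, Nat.cast_one, ha]
      linarith
  have hdrop : (((sortedDesc v).drop l).map fun y => max (y - s) 0).sum = 0 := by
    refine List.sum_eq_zero fun y hy => ?_
    obtain ⟨z, hz, rfl⟩ := List.mem_map.1 hy
    exact max_eq_right (sub_nonpos.2 (le_nthLargest_of_mem_drop h1 hl v hz))
  have hlen : ((sortedDesc v).take l).length = l := by
    rw [List.length_take, length_sortedDesc, min_eq_left hl]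
  have hsplit : ((sortedDesc v).map fun y => max (y - s) 0).sum =
      (((sortedDesc v).take l).map fun y => max (y - s) 0).sum +
      (((sortedDesc v).drop l).map fun y => max (y - s) 0).sum := by
    rw [← List.sum_append, ← List.map_append, List.take_append_drop]
  have := aux ((sortedDesc v).take l) fun y hy => nthLargest_le_of_mem_take h1 hl v hy
  rw [hlen] at this
  rw [← sum_map_sortedDesc v fun y => max (y - s) 0, topSum]
  linarith

theorem card_lt_entries_le {l : ℕ} (h1 : 1 ≤ l) (hl : l ≤ Fintype.card C) (v : C → ℝ) {t : ℝ}
    (ht : nthLargest l v ≤ t) : ∑ j, (if t < v j then (1 : ℝ) else 0) ≤ l := by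
  rw [← sum_map_sortedDesc v fun y => if t < y then (1 : ℝ) else 0]
  have hdrop : (((sortedDesc v).drop l).map fun y => if t < y then (1 : ℝ) else 0).sum = 0 := by
    refine List.sum_eq_zero fun y hy => ?_
    obtain ⟨z, hz, rfl⟩ := List.mem_map.1 hy
    exact if_neg (not_lt.2 ((le_nthLargest_of_mem_drop h1 hl v hz).trans ht))
  have aux : ∀ L : List ℝ, (L.map fun y => if t < y then (1 : ℝ) else 0).sum ≤ L.length := by
    intro L
    induction L with
    | nil => simp
    | cons a L ih =>
      simp only [List.length_cons, List.map_cons, List.sum_cons, Nat.cast_add, Nat.cast_one]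
      split_ifs <;> linarith
  rw [← List.take_append_drop l (sortedDesc v), List.map_append, List.sum_append, hdrop, add_zero]
  exact (aux _).trans (by exact_mod_cast List.length_take_le l _)

end TopSum

/-! ### Sampling from a single cluster -/

section Cluster

variable {C : Type*}

/-- Sampling from a cluster `A` with probability proportional to `V`. Here `x j` is the excess of
`j` over the threshold `t` in the optimal solution, `W` is the padded optimal cost of the cluster,
and `Φ s` is the cost of the cluster once `s` has become a center. If the current cost of the
cluster exceeds `7 * W`, then at least two thirds of the sampling weight lies on points that bring
the cost down to `7 * W`. -/
theorem two_thirds_weight_repairs (A : Finset C) (V x Φ : C → ℝ) {t W : ℝ} (ht : 0 ≤ t)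
    (hx : ∀ j, 0 ≤ x j)
    (hW : W = ∑ j ∈ A, (x j + if 0 < x j then 2 * t else 0))
    (hΦ : ∀ s ∈ A, Φ s ≤ ∑ j ∈ A, (x j + x s))
    (hV : ∀ s ∈ A, ∀ j ∈ A, V s ≤ V j + 2 * t + x j + x s)
    (hbad : 7 * W < ∑ j ∈ A, V j) :
    2 / 3 * ∑ j ∈ A, V j ≤ ∑ s ∈ A with Φ s ≤ 7 * W, V s := by
  set B := A.filter fun s => ¬ Φ s ≤ 7 * W with hB
  set O := ∑ j ∈ A, x j with hO
  set T := ∑ j ∈ A, V j with hT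
  have hsplit : ∑ s ∈ A with Φ s ≤ 7 * W, V s + ∑ s ∈ B, V s = T :=
    Finset.sum_filter_add_sum_filter_not A _ _
  have hterm : ∀ j, x j ≤ x j + if 0 < x j then 2 * t else 0 := by
    intro j; split_ifs <;> linarith
  have hOW : O ≤ W := by rw [hW]; exact Finset.sum_le_sum fun j _ => hterm j
  have hO0 : 0 ≤ O := Finset.sum_nonneg fun j _ => hx j
  have hW0 : 0 ≤ W := hO0.trans hOW
  have hBA : B ⊆ A := Finset.filter_subset _ _
  have hn : (0 : ℝ) < A.card := by
    rcases A.eq_empty_or_nonempty with h | h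
    · simp [hT, h] at hbad; linarith
    · exact_mod_cast h.card_pos
  -- Only points of large excess fail to repair the cluster.
  have hBx : ∀ s ∈ B, 6 * W < A.card * x s := by
    intro s hs
    obtain ⟨hsA, hs⟩ := Finset.mem_filter.1 hs
    have h := hΦ s hsA
    rw [Finset.sum_add_distrib, Finset.sum_const, nsmul_eq_mul] at h
    push Not at hs
    linarith
  have hBpos : ∀ s ∈ B, 0 < x s := by
    intro s hs
    have := hBx s hs
    exact pos_of_mul_pos_right (by linarith) hn.le
  have hBO : ∑ s ∈ B, x s ≤ O := Finset.sum_le_sum_of_subset_of_nonneg hBA fun j _ _ => hx j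
  -- By Markov's inequality, they are at most a sixth of the cluster.
  have hcard : 6 * (B.card : ℝ) ≤ A.card := by
    rcases B.eq_empty_or_nonempty with h | ⟨s, hs⟩
    · simp [h]
    · have hWpos : 0 < W := (hBpos s hs).trans_le
        ((Finset.single_le_sum (fun j _ => hx j) (hBA hs)).trans hOW)
      have h1 : ∑ s ∈ B, 6 * W ≤ ∑ s ∈ B, A.card * x s :=
        Finset.sum_le_sum fun s hs => (hBx s hs).le
      rw [Finset.sum_const, nsmul_eq_mul, ← Finset.mul_sum] at h1
      have h2 : (A.card : ℝ) * ∑ s ∈ B, x s ≤ A.card * W :=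
        mul_le_mul_of_nonneg_left (hBO.trans hOW) hn.le
      exact le_of_mul_le_mul_right (by linarith) hWpos
  have hBW : ∑ s ∈ B, (x s + 2 * t) ≤ W := by
    rw [hW]
    refine (Finset.sum_le_sum fun s hs => ?_).trans
      (Finset.sum_le_sum_of_subset_of_nonneg hBA fun j _ _ => (hx j).trans (hterm j))
    rw [if_pos (hBpos s hs)]
  -- Average the comparison of `V s` with `V j` over `j ∈ A`, then sum over `s ∈ B`.
  have hVs : ∀ s ∈ B, A.card * V s ≤ T + O + A.card * (x s + 2 * t) := by
    intro s hs
    have h : ∑ j ∈ A, V s ≤ ∑ j ∈ A, (V j + x j + (x s + 2 * t)) :=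
      Finset.sum_le_sum fun j hj => by linarith [hV s (hBA hs) j hj]
    simpa only [Finset.sum_add_distrib, Finset.sum_const, nsmul_eq_mul, ← hT, ← hO, mul_add]
      using h
  have hsum := Finset.sum_le_sum hVs
  rw [← Finset.mul_sum, Finset.sum_add_distrib, Finset.sum_const, nsmul_eq_mul,
    ← Finset.mul_sum] at hsum
  have h1 : (B.card : ℝ) * (T + O) ≤ A.card / 6 * (T + T / 7) :=
    mul_le_mul (by linarith) (by linarith) (by linarith) (by positivity)
  have h2 : (A.card : ℝ) * ∑ s ∈ B, (x s + 2 * t) ≤ A.card * (T / 7) :=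
    mul_le_mul_of_nonneg_left (by linarith) hn.le
  have h3 : ∑ s ∈ B, V s ≤ T / 3 := le_of_mul_le_mul_left (by linarith) hn
  linarith

end Cluster

/-! ### One round of sampling -/

section Round

variable {C : Type*} [PseudoMetricSpace C]

/-- The excess `(d(j, S) - s)⁺` of the connection cost of `j` over the threshold `s`. -/
noncomputable def excess (s : ℝ) (S : Finset C) (j : C) : ℝ := max (costVec S j - s) 0

theorem excess_nonneg (s : ℝ) (S : Finset C) (j : C) : 0 ≤ excess s S j := le_max_right _ _

theorem costVec_nonneg (S : Finset C) (j : C) : 0 ≤ costVec S j := Metric.infDist_nonneg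

theorem weight_eq_ofReal_excess (t : ℝ) (S : Finset C) (j : C) :
    weight t S j = ENNReal.ofReal (excess (2 * t) S j) := rfl

open Classical in
theorem excess_insert_le (s : ℝ) {S : Finset C} (hS : S.Nonempty) (a j : C) :
    excess s (insert a S) j ≤ excess s S j := by
  refine max_le_max_right _ (sub_le_sub_right ?_ _)
  exact Metric.infDist_le_infDist_of_subset (by simp) (by simpa using hS)

theorem excess_le_of_common_center (t : ℝ) (S Sopt : Finset C) {a s j : C}
    (hs : costVec Sopt s = dist s a) (hj : costVec Sopt j = dist j a) :
    excess (2 * t) S s ≤ excess (2 * t) S j + 2 * t + excess t Sopt j + excess t Sopt s := by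
  have h1 : costVec S s ≤ costVec S j + dist s j := Metric.infDist_le_infDist_add_dist
  have h2 := dist_triangle_right s j a
  have h3 : costVec S j - 2 * t ≤ excess (2 * t) S j := le_max_left _ _
  have h4 : costVec Sopt s - t ≤ excess t Sopt s := le_max_left _ _
  have h5 : costVec Sopt j - t ≤ excess t Sopt j := le_max_left _ _
  have h6 := excess_nonneg (2 * t) S j
  have h7 : 0 ≤ costVec Sopt s := Metric.infDist_nonneg
  have h8 : 0 ≤ costVec Sopt j := Metric.infDist_nonneg
  refine max_le (by linarith) (by linarith)

open Classical in
theorem excess_insert_le_of_common_center (t : ℝ) (S Sopt : Finset C) {a s j : C}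
    (hs : costVec Sopt s = dist s a) (hj : costVec Sopt j = dist j a) :
    excess (2 * t) (insert s S) j ≤ excess t Sopt j + excess t Sopt s := by
  have h1 : costVec (insert s S) j ≤ dist j s := Metric.infDist_le_dist_of_mem (by simp)
  have h2 := dist_triangle_right j s a
  have h4 : costVec Sopt s - t ≤ excess t Sopt s := le_max_left _ _
  have h5 : costVec Sopt j - t ≤ excess t Sopt j := le_max_left _ _
  refine max_le (by linarith) (add_nonneg (excess_nonneg _ _ _) (excess_nonneg _ _ _))

theorem exists_nearest_center {S : Finset C} (hS : S.Nonempty) (j : C) :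
    ∃ a ∈ S, costVec S j = dist j a :=
  S.finite_toSet.isCompact.exists_infDist_eq_dist (by simpa using hS) j

variable [Fintype C]

/-- The sampling objective `∑ j, (d(j, S) - 2t)⁺`. -/
noncomputable def potential (t : ℝ) (S : Finset C) : ℝ := ∑ j, excess (2 * t) S j

/-- The padded optimal cost of `j`: its excess over `t` in the solution `Sopt`, raised by `2t` if
it is positive. -/
noncomputable def paddedCost (t : ℝ) (Sopt : Finset C) (j : C) : ℝ :=
  excess t Sopt j + if 0 < excess t Sopt j then 2 * t else 0

open Classical in
/-- The bad centers of `Sopt` for the assignment `f : C → C`: those whose cluster `f ⁻¹' {a}` costs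
more than `7` times its padded cost when served by `S`. -/
noncomputable def badCenters (t : ℝ) (Sopt : Finset C) (f : C → C) (S : Finset C) : Finset C :=
  {a ∈ Sopt | 7 * ∑ j with f j = a, paddedCost t Sopt j < ∑ j with f j = a, excess (2 * t) S j}

open Classical in
theorem potential_insert_le (t : ℝ) {S : Finset C} (hS : S.Nonempty) (a : C) :
    potential t (insert a S) ≤ potential t S :=
  Finset.sum_le_sum fun j _ => excess_insert_le _ hS a j

open Classical in
theorem badCenters_insert_subset (t : ℝ) (Sopt : Finset C) (f : C → C) {S : Finset C}
    (hS : S.Nonempty) (a : C) :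
    badCenters t Sopt f (insert a S) ⊆ badCenters t Sopt f S := fun b hb => by
  rw [badCenters, Finset.mem_filter] at hb ⊢
  exact ⟨hb.1, hb.2.trans_le (Finset.sum_le_sum fun j _ => excess_insert_le _ hS a j)⟩

open Classical in
/-- As long as the sampling objective exceeds `33 / 2` times the total padded cost, at least a
third of the sampling weight lies on points that repair their own bad cluster. -/
theorem third_weight_repairs {t : ℝ} (ht : 0 ≤ t) {Sopt : Finset C} {f : C → C}
    (hf : ∀ j, f j ∈ Sopt ∧ costVec Sopt j = dist j (f j)) (S : Finset C)
    (hlarge : 33 / 2 * ∑ j, paddedCost t Sopt j < potential t S) :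
    1 / 3 * potential t S ≤
      ∑ s with f s ∈ badCenters t Sopt f S ∧ f s ∉ badCenters t Sopt f (insert s S),
        excess (2 * t) S s := by
  have hpad : ∀ j, 0 ≤ paddedCost t Sopt j := fun j => by
    have := excess_nonneg t Sopt j
    rw [paddedCost]; split_ifs <;> linarith
  have hmaps : ∀ j ∈ (Finset.univ : Finset C), f j ∈ Sopt := fun j _ => (hf j).1
  set D := badCenters t Sopt f S with hD
  have hDsub : D ⊆ Sopt := Finset.filter_subset _ _
  have hpot : potential t S = ∑ a ∈ Sopt, ∑ j with f j = a, excess (2 * t) S j :=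
    (Finset.sum_fiberwise_of_maps_to hmaps _).symm
  -- The good clusters carry little weight.
  have hgood : ∑ a ∈ Sopt \ D, ∑ j with f j = a, excess (2 * t) S j ≤
      7 * ∑ j, paddedCost t Sopt j := by
    rw [← Finset.sum_fiberwise_of_maps_to hmaps, Finset.mul_sum]
    refine (Finset.sum_le_sum fun a ha => ?_).trans
      (Finset.sum_le_sum_of_subset_of_nonneg (Finset.sdiff_subset (s := Sopt) (t := D))
        fun a _ _ => mul_nonneg (by norm_num) (Finset.sum_nonneg fun j _ => hpad j))
    obtain ⟨ha, haD⟩ := Finset.mem_sdiff.1 ha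
    by_contra h
    exact haD (Finset.mem_filter.2 ⟨ha, not_le.1 h⟩)
  have hsplit := Finset.sum_sdiff (f := fun a => ∑ j with f j = a, excess (2 * t) S j) hDsub
  -- Each bad cluster is repaired by two thirds of its weight.
  have hbad : ∀ a ∈ D, 2 / 3 * ∑ j with f j = a, excess (2 * t) S j ≤
      ∑ s with (f s ∈ D ∧ f s ∉ badCenters t Sopt f (insert s S)) ∧ f s = a,
        excess (2 * t) S s := by
    intro a ha
    have hcen : ∀ j ∈ (Finset.univ.filter fun j => f j = a), costVec Sopt j = dist j a := by
      intro j hj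
      rw [← (Finset.mem_filter.1 hj).2]
      exact (hf j).2
    have := two_thirds_weight_repairs (Finset.univ.filter fun j => f j = a)
      (excess (2 * t) S) (excess t Sopt)
      (fun s => ∑ j with f j = a, excess (2 * t) (insert s S) j) ht
      (excess_nonneg t Sopt) (W := ∑ j with f j = a, paddedCost t Sopt j) rfl
      (fun s hs => Finset.sum_le_sum fun j hj =>
        excess_insert_le_of_common_center t S Sopt (hcen s hs) (hcen j hj))
      (fun s hs j hj => excess_le_of_common_center t S Sopt (hcen s hs) (hcen j hj))
      (Finset.mem_filter.1 ha).2
    refine this.trans (Finset.sum_le_sum_of_subset_of_nonneg ?_ fun j _ _ => excess_nonneg _ _ _)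
    intro s hs
    simp only [Finset.mem_filter, Finset.mem_univ, true_and] at hs ⊢
    obtain ⟨rfl, hs⟩ := hs
    exact ⟨⟨ha, fun h => absurd (Finset.mem_filter.1 h).2 (not_lt.2 hs)⟩, rfl⟩
  have hsum := Finset.sum_le_sum hbad
  rw [← Finset.mul_sum] at hsum
  have hfib : ∑ a ∈ D, ∑ s with (f s ∈ D ∧ f s ∉ badCenters t Sopt f (insert s S)) ∧ f s = a,
      excess (2 * t) S s = ∑ s with f s ∈ D ∧ f s ∉ badCenters t Sopt f (insert s S),
        excess (2 * t) S s := by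
    simp_rw [← Finset.filter_filter]
    exact Finset.sum_fiberwise_of_maps_to (fun s hs =>
      (Finset.mem_filter.1 (Finset.mem_filter.1 hs).1).2) _
  rw [hfib] at hsum
  have hpad0 : 0 ≤ ∑ j, paddedCost t Sopt j := Finset.sum_nonneg fun j _ => hpad j
  linarith

variable [Nonempty C]

theorem sum_toReal_eq_one {α : Type*} [Fintype α] (p : PMF α) : ∑ a, (p a).toReal = 1 := by
  rw [← ENNReal.toReal_sum fun a _ => p.apply_ne_top a, ← tsum_fintype (L := .unconditional α),
    p.tsum_coe, ENNReal.toReal_one]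

theorem nextCenter_toReal {t : ℝ} (fallback : Finset C → PMF C) {S : Finset C} (hS : S.Nonempty)
    (hpos : 0 < potential t S) (s : C) :
    (nextCenter t fallback S s).toReal = excess (2 * t) S s / potential t S := by
  have hsum : ∑' j, weight t S j = ENNReal.ofReal (potential t S) := by
    rw [tsum_fintype, potential, ENNReal.ofReal_sum_of_nonneg fun j _ => excess_nonneg _ _ _]
    rfl
  have hne : ¬ ∑' j, weight t S j = 0 := by
    rw [hsum, ENNReal.ofReal_eq_zero, not_le]; exact hpos
  rw [nextCenter, if_neg hS.ne_empty, dif_neg hne, PMF.normalize_apply, hsum,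
    weight_eq_ofReal_excess, ENNReal.toReal_mul, ENNReal.toReal_inv,
    ENNReal.toReal_ofReal hpos.le, ENNReal.toReal_ofReal (excess_nonneg _ _ _), div_eq_mul_inv]

open Classical in
/-- The drift inequality: in one round the expected number of bad centers does not increase, and
it drops by at least `1 / 3` while the sampling objective exceeds `K`. -/
theorem expected_badCenters_insert_add_le {t K : ℝ} (ht : 0 ≤ t) {Sopt : Finset C} {f : C → C}
    (hf : ∀ j, f j ∈ Sopt ∧ costVec Sopt j = dist j (f j)) (fallback : Finset C → PMF C)
    (hK0 : 0 ≤ K) (hK : 33 / 2 * ∑ j, paddedCost t Sopt j ≤ K) {S : Finset C} (hS : S.Nonempty) :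
    ∑ s, (nextCenter t fallback S s).toReal * ((badCenters t Sopt f (insert s S)).card : ℝ) +
      1 / 3 * (if K < potential t S then 1 else 0) ≤ ((badCenters t Sopt f S).card : ℝ) := by
  set D := badCenters t Sopt f S with hD
  have hcard : ∀ s, ((badCenters t Sopt f (insert s S)).card : ℝ) ≤
      D.card - if f s ∈ D ∧ f s ∉ badCenters t Sopt f (insert s S) then 1 else 0 := by
    intro s
    have hsub := badCenters_insert_subset t Sopt f hS s
    split_ifs with h
    · have := Finset.card_lt_card ((Finset.ssubset_iff_of_subset hsub).2 ⟨f s, h⟩)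
      rw [le_sub_iff_add_le]
      exact_mod_cast this
    · rw [sub_zero]
      exact_mod_cast Finset.card_le_card hsub
  have hmean : ∑ s, (nextCenter t fallback S s).toReal *
        ((badCenters t Sopt f (insert s S)).card : ℝ) ≤
      D.card - ∑ s with f s ∈ D ∧ f s ∉ badCenters t Sopt f (insert s S),
        (nextCenter t fallback S s).toReal := by
    refine (Finset.sum_le_sum fun s _ =>
      mul_le_mul_of_nonneg_left (hcard s) ENNReal.toReal_nonneg).trans (le_of_eq ?_)
    simp_rw [mul_sub, Finset.sum_sub_distrib, ← Finset.sum_mul, sum_toReal_eq_one, one_mul,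
      mul_ite, mul_one, mul_zero, Finset.sum_filter]
  split_ifs with h
  · have hpos : 0 < potential t S := hK0.trans_lt h
    have hrep := third_weight_repairs ht hf S (hK.trans_lt h)
    have : 1 / 3 ≤ ∑ s with f s ∈ D ∧ f s ∉ badCenters t Sopt f (insert s S),
        (nextCenter t fallback S s).toReal := by
      simp_rw [nextCenter_toReal fallback hS hpos]
      rw [← Finset.sum_div, le_div_iff₀ hpos]
      exact hrep
    linarith
  · have : 0 ≤ ∑ s with f s ∈ D ∧ f s ∉ badCenters t Sopt f (insert s S),
        (nextCenter t fallback S s).toReal := Finset.sum_nonneg fun s _ => ENNReal.toReal_nonneg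
    linarith

end Round

/-! ### The whole process -/

section Sampling

variable {C : Type*} [Fintype C] [Nonempty C] [PseudoMetricSpace C]

theorem card_le_and_nonempty_of_mem_support (t : ℝ) (fallback : Finset C → PMF C) (i : ℕ) :
    ∀ S ∈ (adSample t fallback i).support, S.card ≤ i ∧ (1 ≤ i → S.Nonempty) := by
  classical
  induction i with
  | zero =>
    intro S hS
    rw [adSample, PMF.support_pure, Set.mem_singleton_iff] at hS
    simp [hS]
  | succ i ih =>
    intro S hS
    rw [adSample, PMF.mem_support_bind_iff] at hS
    obtain ⟨T, hT, hS⟩ := hS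
    rw [PMF.mem_support_map_iff] at hS
    obtain ⟨s, -, rfl⟩ := hS
    refine ⟨?_, fun _ => Finset.insert_nonempty _ _⟩
    have := (ih T hT).1
    refine le_trans ?_ (Nat.succ_le_succ this)
    convert Finset.card_insert_le s T

/-- The expectation of `F` over the center-set after `i` rounds. -/
noncomputable def expect (t : ℝ) (fallback : Finset C → PMF C) (i : ℕ) (F : Finset C → ℝ) : ℝ :=
  ∑ S, (adSample t fallback i S).toReal * F S

open Classical in
theorem expect_succ (t : ℝ) (fallback : Finset C → PMF C) (i : ℕ) (F : Finset C → ℝ) :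
    expect t fallback (i + 1) F =
      expect t fallback i fun S => ∑ s, (nextCenter t fallback S s).toReal * F (insert s S) := by
  have hbind : ∀ T, (adSample t fallback (i + 1) T).toReal =
      ∑ S, (adSample t fallback i S).toReal *
        ∑ s, if T = insert s S then (nextCenter t fallback S s).toReal else 0 := by
    intro T
    rw [adSample, PMF.bind_apply, tsum_fintype, ENNReal.toReal_sum fun S _ =>
      ENNReal.mul_ne_top (PMF.apply_ne_top _ _) (PMF.apply_ne_top _ _)]
    refine Finset.sum_congr rfl fun S _ => ?_
    rw [ENNReal.toReal_mul, PMF.map_apply, tsum_fintype, ENNReal.toReal_sum]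
    · congr 1
      refine Finset.sum_congr rfl fun s _ => ?_
      split_ifs <;> rfl
    · intro s _
      split_ifs
      · exact PMF.apply_ne_top _ _
      · exact ENNReal.zero_ne_top
  simp_rw [expect, hbind, Finset.sum_mul]
  rw [Finset.sum_comm]
  refine Finset.sum_congr rfl fun S _ => ?_
  simp_rw [mul_assoc, ← Finset.mul_sum, Finset.sum_mul]
  rw [Finset.sum_comm]
  simp

/-- Expectations compare pointwise on nonempty sets from the first round on. -/
theorem expect_mono (t : ℝ) (fallback : Finset C → PMF C) {i : ℕ} (hi : 1 ≤ i)
    {F G : Finset C → ℝ} (h : ∀ S : Finset C, S.Nonempty → F S ≤ G S) :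
    expect t fallback i F ≤ expect t fallback i G := by
  refine Finset.sum_le_sum fun S _ => ?_
  by_cases hS : S ∈ (adSample t fallback i).support
  · exact mul_le_mul_of_nonneg_left
      (h S ((card_le_and_nonempty_of_mem_support t fallback i S hS).2 hi)) ENNReal.toReal_nonneg
  · rw [PMF.mem_support_iff, not_not] at hS
    simp [hS]

theorem expect_add_mul (t : ℝ) (fallback : Finset C → PMF C) (i : ℕ) (F G : Finset C → ℝ)
    (b : ℝ) : expect t fallback i (fun S => F S + b * G S) =
      expect t fallback i F + b * expect t fallback i G := by
  simp_rw [expect, mul_add, Finset.sum_add_distrib, Finset.mul_sum]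
  congr 1
  exact Finset.sum_congr rfl fun S _ => by ring

theorem expect_const (t : ℝ) (fallback : Finset C → PMF C) (i : ℕ) (b : ℝ) :
    expect t fallback i (fun _ => b) = b := by
  rw [expect, ← Finset.sum_mul, sum_toReal_eq_one, one_mul]

open Classical in
/-- After `m + 1` rounds the probability that the sampling objective still exceeds `K` is at most
`3k / m`: up to then, each round but the first lowers the expected number of bad centers, which
is at most `k`, by a third of that probability. -/
theorem mul_expect_potential_large_le {t K : ℝ} (ht : 0 ≤ t) {Sopt : Finset C} {k : ℕ}
    (hSopt : IsSolution k Sopt) (fallback : Finset C → PMF C)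
    (hK0 : 0 ≤ K) (hK : 33 / 2 * ∑ j, paddedCost t Sopt j ≤ K) (m : ℕ) :
    m * expect t fallback (m + 1) (fun S => if K < potential t S then 1 else 0) ≤ 3 * k := by
  choose f hf using exists_nearest_center hSopt.1
  set bad : Finset C → ℝ := fun S => ((badCenters t Sopt f S).card : ℝ)
  set large : Finset C → ℝ := fun S => if K < potential t S then 1 else 0
  have hanti : ∀ i, expect t fallback (i + 2) large ≤ expect t fallback (i + 1) large := by
    intro i
    rw [expect_succ t fallback (i + 1)]
    refine expect_mono t fallback (by omega) fun S hS => ?_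
    have : ∀ s, large (insert s S) ≤ large S := by
      intro s
      have := potential_insert_le t hS s
      simp only [large]
      split_ifs <;> linarith
    refine (Finset.sum_le_sum fun s _ =>
      mul_le_mul_of_nonneg_left (this s) ENNReal.toReal_nonneg).trans ?_
    rw [← Finset.sum_mul, sum_toReal_eq_one, one_mul]
  have hdrift : ∀ i, expect t fallback (i + 2) bad + 1 / 3 * expect t fallback (i + 1) large ≤
      expect t fallback (i + 1) bad := by
    intro i
    rw [expect_succ t fallback (i + 1), ← expect_add_mul]
    exact expect_mono t fallback (by omega) fun S hS =>
      expected_badCenters_insert_add_le ht hf fallback hK0 hK hS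
  have hmain : ∀ m : ℕ, m * expect t fallback (m + 1) large +
      3 * expect t fallback (m + 1) bad ≤ 3 * k := by
    intro m
    induction m with
    | zero =>
      have : expect t fallback 1 bad ≤ expect t fallback 1 fun _ => (k : ℝ) := by
        refine expect_mono t fallback le_rfl fun S _ => ?_
        have h : (badCenters t Sopt f S).card ≤ k :=
          (Finset.card_le_card (Finset.filter_subset _ _)).trans hSopt.2
        exact Nat.cast_le.2 h
      rw [expect_const] at this
      simp only [Nat.cast_zero, zero_mul, zero_add]
      linarith
    | succ m ih =>
      have h1 := hanti m
      have h2 := hdrift m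
      have h3 := mul_le_mul_of_nonneg_left h1 (show (0 : ℝ) ≤ (m : ℝ) + 1 by positivity)
      push_cast
      linarith
  have hbad : 0 ≤ expect t fallback (m + 1) bad :=
    Finset.sum_nonneg fun S _ => mul_nonneg ENNReal.toReal_nonneg (Nat.cast_nonneg _)
  linarith [hmain m]

open Classical in
theorem one_sub_expect_eq_toOuterMeasure (t : ℝ) (fallback : Finset C → PMF C) (i : ℕ)
    (P : Finset C → Prop) :
    ENNReal.ofReal (1 - expect t fallback i fun S => if P S then 1 else 0) =
      (adSample t fallback i).toOuterMeasure {S | ¬ P S} := by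
  have h : (1 - expect t fallback i fun S => if P S then 1 else 0) =
      ∑ S, if P S then 0 else (adSample t fallback i S).toReal := by
    rw [← sum_toReal_eq_one (adSample t fallback i), expect, ← Finset.sum_sub_distrib]
    refine Finset.sum_congr rfl fun S _ => ?_
    by_cases hS : P S <;> simp [hS, sum_toReal_eq_one]
  rw [h, PMF.toOuterMeasure_apply, tsum_fintype, ENNReal.ofReal_sum_of_nonneg]
  · refine Finset.sum_congr rfl fun S _ => ?_
    by_cases hS : P S
    · simp [hS]
    · simp [hS, ENNReal.ofReal_toReal (PMF.apply_ne_top _ _)]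
  · intro S _
    split_ifs
    · exact le_rfl
    · exact ENNReal.toReal_nonneg

end Sampling

/-! ### Comparison with the optimum -/

section Comparison

theorem rounds_le {k : ℕ} (hk : 1 ≤ k) : rounds k ≤ 56 * k := by
  have h1 : (1 : ℝ) ≤ k := by exact_mod_cast hk
  have : Real.sqrt k ≤ k := Real.sqrt_le_iff.2 ⟨by linarith, by nlinarith⟩
  rw [rounds, Nat.ceil_le]
  push_cast
  linarith

theorem lt_rounds {k : ℕ} (hk : 1 ≤ k) : 28 * k < rounds k := by
  have h1 : (1 : ℝ) ≤ k := by exact_mod_cast hk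
  have : 0 < Real.sqrt k := Real.sqrt_pos.2 (by linarith)
  rw [rounds, Nat.lt_ceil]
  push_cast
  linarith

variable {C : Type*} [Fintype C] [PseudoMetricSpace C]

/-- Consequences of the upper bound on the guess `t`: both the total threshold `l * t` and half of
the total padded cost are at most `(1 + ε)` times the cost of `S`. At most `l` points have a
positive excess over `t`, so the padding amounts to at most `2 * t * l`. -/
theorem threshold_and_paddedCost_le {l : ℕ} (h1 : 1 ≤ l) (hl : l ≤ Fintype.card C) {ε t : ℝ}
    (hε : 0 < ε) (S : Finset C) (hlow : nthLargest l (costVec S) ≤ t)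
    (hup : t ≤ max ((1 + ε) * nthLargest l (costVec S)) (ε * cost l S / l)) :
    l * t ≤ (1 + ε) * cost l S ∧ ∑ j, paddedCost t S j ≤ 2 * (1 + ε) * cost l S := by
  set τ := nthLargest l (costVec S) with hτ
  have hτ0 : 0 ≤ τ := nthLargest_nonneg l (costVec_nonneg S)
  have hl0 : (0 : ℝ) < l := by exact_mod_cast h1
  have hM : l * τ + ∑ j, excess τ S j ≤ cost l S := add_sum_posPart_le_topSum h1 hl _
  have hex0 : 0 ≤ ∑ j, excess τ S j := Finset.sum_nonneg fun j _ => excess_nonneg _ _ _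
  have hex : ∑ j, excess t S j ≤ ∑ j, excess τ S j :=
    Finset.sum_le_sum fun j _ => max_le_max_right _ (by linarith)
  have hlτ : 0 ≤ l * τ := by positivity
  have hpad : ∑ j, paddedCost t S j ≤ ∑ j, excess t S j + 2 * (l * t) := by
    have hcount := card_lt_entries_le h1 hl (costVec S) hlow
    have heq : ∀ j, (if 0 < excess t S j then 2 * t else 0) =
        2 * t * if t < costVec S j then (1 : ℝ) else 0 := by
      intro j
      simp [excess]
    simp_rw [paddedCost, Finset.sum_add_distrib, heq, ← Finset.mul_sum]
    have := mul_le_mul_of_nonneg_left hcount (show 0 ≤ 2 * t by linarith)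
    linarith
  have hε1 : ε * (l * τ) ≤ ε * cost l S := mul_le_mul_of_nonneg_left (by linarith) hε.le
  rcases le_max_iff.1 hup with h | h
  · have h' := mul_le_mul_of_nonneg_left h hl0.le
    constructor <;> linarith
  · have h' := (le_div_iff₀ hl0).1 h
    constructor <;> linarith

end Comparison

end LCentrum

theorem mainTheorem4 :
    ∃ c : ℝ, 0 < c ∧
      ∀ (C : Type*) [Fintype C] [Nonempty C] [PseudoMetricSpace C] (k l : ℕ) (ε t : ℝ)
        (Sopt : Finset C) (fallback : Finset C → PMF C),
        1 ≤ k → 1 ≤ l → l ≤ Fintype.card C → 0 < ε →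
        LCentrum.IsOptimal k l Sopt →
        LCentrum.nthLargest l (LCentrum.costVec Sopt) ≤ t →
        t ≤ max ((1 + ε) * LCentrum.nthLargest l (LCentrum.costVec Sopt))
              (ε * LCentrum.opt C k l / l) →
        (∀ S ∈ (LCentrum.adSample t fallback (LCentrum.rounds k)).support,
          S.Nonempty ∧ S.card ≤ 56 * k) ∧
        ENNReal.ofReal c ≤
          (LCentrum.adSample t fallback (LCentrum.rounds k)).toOuterMeasure
            {S | LCentrum.cost l S ≤ 35 * (1 + ε) * LCentrum.opt C k l} := by
  classical
  refine ⟨25 / 28, by norm_num, ?_⟩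
  intro C _ _ _ k l ε t Sopt fallback hk h1 hl hε hopt hlow hup
  have hN := LCentrum.lt_rounds hk
  refine ⟨fun S hS => ?_, ?_⟩
  · obtain ⟨hcard, hne⟩ := LCentrum.card_le_and_nonempty_of_mem_support t fallback _ S hS
    exact ⟨hne (by omega), hcard.trans (LCentrum.rounds_le hk)⟩
  · rw [← hopt.2] at hup ⊢
    set M := LCentrum.cost l Sopt with hM
    have ht : 0 ≤ t := (LCentrum.nthLargest_nonneg l (LCentrum.costVec_nonneg Sopt)).trans hlow
    obtain ⟨hlt, hpad⟩ := LCentrum.threshold_and_paddedCost_le h1 hl hε Sopt hlow hup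
    have hK0 : 0 ≤ 33 * ((1 + ε) * M) :=
      mul_nonneg (by norm_num) (le_trans (by positivity) hlt)
    obtain ⟨m, hm⟩ : ∃ m, LCentrum.rounds k = m + 1 := ⟨_, (Nat.sub_add_cancel (by omega)).symm⟩
    have hfail := LCentrum.mul_expect_potential_large_le ht hopt.1 fallback hK0
      (by linarith) m
    set π := LCentrum.expect t fallback (m + 1)
      (fun S => if 33 * ((1 + ε) * M) < LCentrum.potential t S then 1 else 0) with hπ
    have hk0 : (0 : ℝ) < k := by exact_mod_cast hk
    have hmk : 28 * (k : ℝ) ≤ m := by exact_mod_cast (show 28 * k ≤ m by omega)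
    have hπ0 : 0 ≤ π := Finset.sum_nonneg fun S _ =>
      mul_nonneg ENNReal.toReal_nonneg (by dsimp only; split_ifs <;> norm_num)
    have hπle : π ≤ 3 / 28 := by
      have := (mul_le_mul_of_nonneg_right hmk hπ0).trans hfail
      refine le_of_mul_le_mul_left (a := 28 * (k : ℝ)) ?_ (by positivity)
      linarith
    rw [hm]
    refine (ENNReal.ofReal_le_ofReal (show 25 / 28 ≤ 1 - π by linarith)).trans ?_
    rw [hπ, LCentrum.one_sub_expect_eq_toOuterMeasure]
    refine MeasureTheory.measure_mono fun S hS => ?_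
    have hS' : LCentrum.potential t S ≤ 33 * ((1 + ε) * M) := not_lt.1 hS
    have htop : LCentrum.cost l S ≤ l * (2 * t) + LCentrum.potential t S :=
      LCentrum.topSum_le_add_sum_posPart l _ (by linarith)
    refine htop.trans ?_
    linarith
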